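/- Let $U=\{q\in\mathbb{H}:|q|=1\}$ be the group of unit quaternions. A quaternion unit gain graph $G^{\varphi}$ is a finite simple graph $G$ with a map $\varphi$ from its oriented edges to $U$ such that $\varphi_{vu}=\varphi_{uv}^{-1}$; its adjacency matrix has the entry $\varphi_{uv}$ at $(u,v)$ if $u$ and $v$ are adjacent, and $0$ otherwise. Its rank $r(G^{\varphi})$ is the row left rank of this matrix, i.e. the maximum number of rows that are linearly independent over $\mathbb{H}$ acting by left multiplication. A cycle $v_1v_2\cdots v_kv_1$ ($k\ge 3$) in $G^{\varphi}$ is of Type 1 if $k$ is even and $\varphi_{v_1v_2}\varphi_{v_2v_3}\cdots\varphi_{v_{k-1}v_k}\varphi_{v_kv_1}=(-1)^{k/2}$. Theorem. Let $G^{\varphi}$ be a connected quaternion unit gain graph with $n$ vertices and maximum degree $\Delta\ge 2$. Then $$r(G^{\varphi})=\frac{n-2}{\Delta-1}$$ if and only if one of the following holds: (i) $G$ is a cycle, and $G^{\varphi}$ is of Type 1; (ii) $n$ is even, $G$ is the complete bipartite graph $K_{n/2,n/2}$, and every 4-cycle in $G^{\varphi}$ is of Type 1. -/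

import Mathlib

open scoped Quaternion

/-- The group `U(ℚ) = {q : |q| = 1}` of unit quaternions, with quaternion multiplication. -/
abbrev UnitQuaternion : Type := Metric.sphere (0 : ℍ[ℝ]) 1

/-- A quaternion unit gain graph: a simple graph together with a gain function from its oriented
edges to the unit quaternions, inverted when an edge is reversed. -/
structure QuaternionGainGraph (V : Type*) where
  /-- The underlying simple graph. -/
  graph : SimpleGraph V
  /-- The gain of an oriented edge. -/
  gain : graph.Dart → UnitQuaternion
  gain_symm : ∀ d : graph.Dart, gain d.symm = (gain d)⁻¹

/-- The row left rank of a quaternion matrix: the maximum number of rows that are left linearly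
independent. The scalar action of `ℍ[ℝ]` on row vectors `n → ℍ[ℝ]` is left multiplication. -/
noncomputable def rowLeftRank {m n : Type*} [Fintype m] (A : Matrix m n ℍ[ℝ]) : ℕ :=
  open Classical in
  (Finset.univ.filter fun s : Finset m =>
    LinearIndependent ℍ[ℝ] (fun i : s => A.row i)).sup Finset.card

namespace QuaternionGainGraph

variable {V : Type*} (Φ : QuaternionGainGraph V)

/-- The adjacency matrix: the entry at `(u, v)` is the gain of the oriented edge from `u` to `v`
if `u` and `v` are adjacent, and `0` otherwise. -/
noncomputable def adjMatrix [DecidableRel Φ.graph.Adj] : Matrix V V ℍ[ℝ] :=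
  Matrix.of fun u v => if h : Φ.graph.Adj u v then (Φ.gain ⟨(u, v), h⟩ : ℍ[ℝ]) else 0

/-- The rank of a quaternion unit gain graph is the row left rank of its adjacency matrix. -/
noncomputable def rank [Fintype V] [DecidableRel Φ.graph.Adj] : ℕ :=
  rowLeftRank Φ.adjMatrix

/-- The gain of a walk: the ordered product of the gains of its oriented edges. -/
noncomputable def walkGain {u v : V} (p : Φ.graph.Walk u v) : UnitQuaternion :=
  (p.darts.map Φ.gain).prod

/-- A cycle of length `n`, traversed as a closed walk `v₁ v₂ … vₙ v₁`, is of Type 1 if `n` is even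
and its gain is `(-1) ^ (n / 2)`. -/
def IsTypeOne {v : V} (c : Φ.graph.Walk v v) : Prop :=
  c.IsCycle ∧ Even c.length ∧ (Φ.walkGain c : ℍ[ℝ]) = (-1) ^ (c.length / 2)

/-- The gain graph is a gain cycle of Type 1: some cycle of Type 1 passes through all vertices and
all edges, so that the graph consists of this cycle only. -/
def IsTypeOneCycle : Prop :=
  ∃ (v : V) (c : Φ.graph.Walk v v),
    Φ.IsTypeOne c ∧ (∀ w : V, w ∈ c.support) ∧ ∀ e ∈ Φ.graph.edgeSet, e ∈ c.edges

/-- The underlying graph is the complete bipartite graph `K_{n/2,n/2}`, where `n` is the (even)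
number of vertices. -/
def IsBalancedCompleteBipartite [Fintype V] : Prop :=
  ∃ m : ℕ, Fintype.card V = 2 * m ∧
    Nonempty (Φ.graph ≃g completeBipartiteGraph (Fin m) (Fin m))

end QuaternionGainGraph

/-! Write d = Δ - 1. Both directions rest on the bound n ≤ 2 + r d. Grow a vertex set S together
with k independent rows supported on S. If S is proper, connectedness gives an edge from some u in S
to some w outside S. The row of u is independent of the chosen rows, because these vanish at column
w. If u already has a neighbour in S, adjoining N(u) adds at most d vertices. So |S| - k d never
increases, and a closed neighbourhood starts it at no more than 2.

Equality makes every such step tight. The graph is then regular and triangle-free. If d = 1, it is a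
cycle with r = n - 2; a left null vector satisfies a two-term recursion along the cycle, and its
solution space has dimension 2 exactly when the gain is of Type 1. If d ≥ 2, the last step of the
growth yields a 4-cycle, which by tightness forces K_{d+1,d+1}, so r = 2. Gain 1 on 4-cycles amounts
to rows on the same side being proportional, which also gives the converse. -/

/-! ### Row left rank as a dimension over the quaternions -/

section Rank

open Module

variable {m n : Type*} [Fintype m]

theorem rowLeftRank_eq_finrank (A : Matrix m n ℍ[ℝ]) :
    rowLeftRank A = finrank ℍ[ℝ] (Submodule.span ℍ[ℝ] (Set.range A.row)) := by
  classical
  have hfin : FiniteDimensional ℍ[ℝ] (Submodule.span ℍ[ℝ] (Set.range A.row)) :=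
    FiniteDimensional.span_of_finite _ (Set.finite_range _)
  apply le_antisymm
  · refine Finset.sup_le fun s hs => ?_
    have hs' : LinearIndependent ℍ[ℝ] (fun i : s => A.row i) := by
      simpa using hs
    have h1 := finrank_span_eq_card hs'
    rw [Fintype.card_coe] at h1
    rw [← h1]
    refine Submodule.finrank_mono (Submodule.span_mono ?_)
    rintro _ ⟨i, rfl⟩
    exact ⟨i, rfl⟩
  · obtain ⟨s, -, -, hspan, hli⟩ :=
      exists_linearIndepOn_extension (K := ℍ[ℝ]) (v := A.row) (s := ∅) (t := Set.univ)
        (by simp) (Set.subset_univ _)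
    have hspan' : Submodule.span ℍ[ℝ] (Set.range A.row)
        ≤ Submodule.span ℍ[ℝ] (Set.range fun i : s.toFinset => A.row i) := by
      rw [Submodule.span_le, ← Set.image_univ]
      refine hspan.trans (Submodule.span_mono ?_)
      rintro _ ⟨i, hi, rfl⟩
      exact ⟨⟨i, by simpa using hi⟩, rfl⟩
    have hli' : LinearIndependent ℍ[ℝ] (fun i : s.toFinset => A.row i) := by
      have h : LinearIndepOn ℍ[ℝ] A.row (s.toFinset : Set m) := by simpa using hli
      exact h
    have hfin' : FiniteDimensional ℍ[ℝ]
        (Submodule.span ℍ[ℝ] (Set.range fun i : s.toFinset => A.row i)) :=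
      FiniteDimensional.span_of_finite _ (Set.finite_range _)
    have hcard := finrank_span_eq_card hli'
    rw [Fintype.card_coe] at hcard
    have hle := Submodule.finrank_mono hspan'
    rw [hcard] at hle
    refine hle.trans (Finset.le_sup (f := Finset.card) ?_)
    simpa using hli'

theorem LinearIndepOn.card_le_rowLeftRank {A : Matrix m n ℍ[ℝ]} {s : Finset m}
    (h : LinearIndepOn ℍ[ℝ] A.row (s : Set m)) : s.card ≤ rowLeftRank A := by
  classical
  refine Finset.le_sup (f := Finset.card) ?_
  rw [Finset.mem_filter]
  exact ⟨Finset.mem_univ _, h⟩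

theorem rowLeftRank_add_finrank_ker (A : Matrix m n ℍ[ℝ]) :
    rowLeftRank A + finrank ℍ[ℝ] (LinearMap.ker (Fintype.linearCombination ℍ[ℝ] A.row))
      = Fintype.card m := by
  rw [rowLeftRank_eq_finrank, ← Fintype.range_linearCombination,
    LinearMap.finrank_range_add_finrank_ker, finrank_fintype_fun_eq_card]

end Rank

/-! ### Independent rows supported on a vertex set -/

namespace QuaternionGainGraph

variable {V : Type*} (Φ : QuaternionGainGraph V) [DecidableRel Φ.graph.Adj]

theorem adjMatrix_of_adj {u v : V} (h : Φ.graph.Adj u v) :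
    Φ.adjMatrix u v = (Φ.gain ⟨(u, v), h⟩ : ℍ[ℝ]) := by
  simp [adjMatrix, h]

theorem adjMatrix_of_not_adj {u v : V} (h : ¬ Φ.graph.Adj u v) : Φ.adjMatrix u v = 0 := by
  simp [adjMatrix, h]

theorem adjMatrix_mul_swap {u v : V} (h : Φ.graph.Adj u v) :
    Φ.adjMatrix u v * Φ.adjMatrix v u = 1 := by
  have h1 := Φ.gain_symm ⟨(u, v), h⟩
  have h2 : Φ.gain ⟨(v, u), h.symm⟩ = (Φ.gain ⟨(u, v), h⟩)⁻¹ := h1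
  rw [adjMatrix_of_adj Φ h, adjMatrix_of_adj Φ h.symm, h2]
  have h3 : Φ.gain ⟨(u, v), h⟩ * (Φ.gain ⟨(u, v), h⟩)⁻¹ = 1 := mul_inv_cancel _
  exact congrArg Subtype.val h3

theorem adjMatrix_ne_zero {u v : V} (h : Φ.graph.Adj u v) : Φ.adjMatrix u v ≠ 0 :=
  left_ne_zero_of_mul_eq_one (Φ.adjMatrix_mul_swap h)

/-- Some `k` linearly independent rows of the adjacency matrix are supported on `S`. -/
def Covers (S : Finset V) (k : ℕ) : Prop :=
  ∃ R : Finset V, R.card = k ∧ LinearIndepOn ℍ[ℝ] Φ.adjMatrix.row (R : Set V) ∧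
    ∀ r ∈ R, ∀ w, Φ.graph.Adj r w → w ∈ S

variable {Φ}

theorem covers_empty : Φ.Covers ∅ 0 :=
  ⟨∅, by simp⟩

theorem Covers.mono {S T : Finset V} {k : ℕ} (h : Φ.Covers S k) (hST : S ⊆ T) : Φ.Covers T k := by
  obtain ⟨R, hk, hR, hS⟩ := h
  exact ⟨R, hk, hR, fun r hr w hw => hST (hS r hr w hw)⟩

variable [Fintype V]

theorem Covers.le_rank {S : Finset V} {k : ℕ} (h : Φ.Covers S k) : k ≤ Φ.rank := by
  obtain ⟨R, rfl, hR, -⟩ := h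
  exact hR.card_le_rowLeftRank

/-- The row of `v` is independent of rows that vanish at one of its neighbours. -/
theorem Covers.union_neighborFinset [DecidableEq V] {S : Finset V} {k : ℕ} (h : Φ.Covers S k)
    {v w : V} (hw : w ∉ S) (hvw : Φ.graph.Adj v w) :
    Φ.Covers (S ∪ Φ.graph.neighborFinset v) (k + 1) := by
  obtain ⟨R, rfl, hR, hS⟩ := h
  have hv : v ∉ R := fun hv => hw (hS v hv w hvw)
  refine ⟨insert v R, Finset.card_insert_of_notMem hv, ?_, ?_⟩
  · rw [Finset.coe_insert]
    refine hR.insert fun hmem => Φ.adjMatrix_ne_zero hvw ?_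
    have hle : Submodule.span ℍ[ℝ] (Φ.adjMatrix.row '' (R : Set V))
        ≤ LinearMap.ker (LinearMap.proj (R := ℍ[ℝ]) (φ := fun _ : V => ℍ[ℝ]) w) := by
      rw [Submodule.span_le]
      rintro _ ⟨r, hr, rfl⟩
      exact Φ.adjMatrix_of_not_adj fun hrw => hw (hS r hr w hrw)
    exact hle hmem
  · intro r hr x hrx
    rw [Finset.mem_union, SimpleGraph.mem_neighborFinset]
    rcases Finset.mem_insert.1 hr with rfl | hr
    · exact Or.inr hrx
    · exact Or.inl (hS r hr x hrx)

end QuaternionGainGraph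

/-! ### Growing a vertex set by neighbourhoods -/

namespace SimpleGraph

variable {V : Type*} {G : SimpleGraph V}

/-- Every vertex of `S` has a neighbour in `S`. -/
def NoIsolatedIn (G : SimpleGraph V) (S : Finset V) : Prop :=
  ∀ v ∈ S, ∃ w ∈ S, G.Adj v w

theorem Connected.exists_adj_of_ne_univ [Fintype V] (hG : G.Connected) {S : Finset V}
    (hS : S.Nonempty) (hS' : S ≠ Finset.univ) : ∃ u ∈ S, ∃ w ∉ S, G.Adj u w := by
  obtain ⟨u, hu⟩ := hS
  obtain ⟨w, hw⟩ : ∃ w, w ∉ S := by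
    by_contra! h
    exact hS' (Finset.eq_univ_iff_forall.2 h)
  obtain ⟨p⟩ := hG.preconnected u w
  obtain ⟨d, -, h1, h2⟩ := p.exists_boundary_dart (S : Set V) hu hw
  exact ⟨d.fst, h1, d.snd, h2, d.adj⟩

variable [Fintype V] [DecidableRel G.Adj] [DecidableEq V]

theorem NoIsolatedIn.union_neighborFinset {S : Finset V} (h : G.NoIsolatedIn S) {u : V}
    (hu : u ∈ S) : G.NoIsolatedIn (S ∪ G.neighborFinset u) := by
  intro v hv
  rcases Finset.mem_union.1 hv with hv | hv
  · obtain ⟨w, hw, hvw⟩ := h v hv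
    exact ⟨w, Finset.mem_union_left _ hw, hvw⟩
  · exact ⟨u, Finset.mem_union_left _ hu, ((G.mem_neighborFinset u v).1 hv).symm⟩

/-- One neighbour of `u` is already in `S`. This saving of one is why Δ - 1, rather than Δ, appears
in the bound. -/
theorem NoIsolatedIn.card_sdiff_lt {S : Finset V} (h : G.NoIsolatedIn S) {u : V}
    (hu : u ∈ S) : (G.neighborFinset u \ S).card + 1 ≤ G.degree u := by
  obtain ⟨w, hw, huw⟩ := h u hu
  rw [← G.card_neighborFinset_eq_degree]
  refine Finset.card_lt_card ⟨Finset.sdiff_subset, fun hsub => ?_⟩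
  have := hsub ((G.mem_neighborFinset u w).2 huw)
  exact (Finset.mem_sdiff.1 this).2 hw

theorem noIsolatedIn_insert_neighborFinset {v w : V} (h : G.Adj v w) :
    G.NoIsolatedIn (insert v (G.neighborFinset v)) := by
  intro x hx
  rcases Finset.mem_insert.1 hx with rfl | hx
  · exact ⟨w, by simpa using Or.inr h, h⟩
  · exact ⟨v, Finset.mem_insert_self _ _, ((G.mem_neighborFinset v x).1 hx).symm⟩

theorem noIsolatedIn_union_neighborFinset {x y : V} (h : G.Adj x y) :
    G.NoIsolatedIn (G.neighborFinset x ∪ G.neighborFinset y) := by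
  intro v hv
  simp only [Finset.mem_union, mem_neighborFinset] at hv ⊢
  rcases hv with hv | hv
  · exact ⟨x, Or.inr h.symm, hv.symm⟩
  · exact ⟨y, Or.inl h, hv.symm⟩

end SimpleGraph

/-! ### The lower bound on the rank -/

namespace QuaternionGainGraph

variable {V : Type*} {Φ : QuaternionGainGraph V} [DecidableRel Φ.graph.Adj] [Fintype V]

/-- The growth argument: each step raises `k` by one and `S.card` by at most `d`, until `S` is
everything and `k` is at most the rank. -/
theorem Covers.card_add_le [DecidableEq V] (hconn : Φ.graph.Connected) {d : ℕ}
    (hd : ∀ v, Φ.graph.degree v ≤ d + 1) {S : Finset V} {k : ℕ} (h : Φ.Covers S k)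
    (hne : S.Nonempty) (hS : Φ.graph.NoIsolatedIn S) :
    Fintype.card V + k * d ≤ S.card + Φ.rank * d := by
  induction hm : Fintype.card V - S.card using Nat.strong_induction_on generalizing S k with
  | _ m ih =>
    by_cases huniv : S = Finset.univ
    · rw [huniv, Finset.card_univ]
      have := Nat.mul_le_mul_right d h.le_rank
      omega
    · obtain ⟨u, hu, w, hw, huw⟩ := hconn.exists_adj_of_ne_univ hne huniv
      have h1 := ih _ ?_ (h.union_neighborFinset hw huw) (hne.mono Finset.subset_union_left)
        (hS.union_neighborFinset hu) rfl
      · have h2 := hS.card_sdiff_lt hu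
        have h3 := hd u
        have h4 : (S ∪ Φ.graph.neighborFinset u).card
            = S.card + (Φ.graph.neighborFinset u \ S).card := by
          rw [← Finset.union_sdiff_self_eq_union, Finset.card_union_of_disjoint
            Finset.disjoint_sdiff]
        have h5 : (k + 1) * d = k * d + d := by ring
        omega
      · have h2 : S.card < (S ∪ Φ.graph.neighborFinset u).card :=
          Finset.card_lt_card ⟨Finset.subset_union_left, fun hsub => hw (hsub (by simp [huw]))⟩
        have h3 := Finset.card_le_univ (S ∪ Φ.graph.neighborFinset u)
        omega

theorem covers_neighborFinset [DecidableEq V] {v w : V} (h : Φ.graph.Adj v w) :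
    Φ.Covers (Φ.graph.neighborFinset v) 1 := by
  simpa using covers_empty.union_neighborFinset (Finset.notMem_empty w) h

theorem covers_union_neighborFinset [DecidableEq V] {x y : V} (h : Φ.graph.Adj x y) :
    Φ.Covers (Φ.graph.neighborFinset x ∪ Φ.graph.neighborFinset y) 2 :=
  (covers_neighborFinset h).union_neighborFinset (w := x) (by simp) h.symm

theorem card_le_two_add_rank_mul (hconn : Φ.graph.Connected) {d : ℕ}
    (hd : ∀ v, Φ.graph.degree v ≤ d + 1) {v w : V} (h : Φ.graph.Adj v w) :
    Fintype.card V ≤ 2 + Φ.rank * d := by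
  classical
  have h1 := ((covers_neighborFinset h).mono (Finset.subset_insert v _)).card_add_le hconn hd
    (Finset.insert_nonempty _ _) (SimpleGraph.noIsolatedIn_insert_neighborFinset h)
  have h2 := Finset.card_insert_le v (Φ.graph.neighborFinset v)
  rw [Φ.graph.card_neighborFinset_eq_degree] at h2
  have h3 := hd v
  omega

end QuaternionGainGraph

/-! ### Structure of the graphs attaining the bound -/

namespace QuaternionGainGraph

variable {V : Type*} {Φ : QuaternionGainGraph V} [DecidableRel Φ.graph.Adj] [Fintype V]

/-- A connected gain graph of maximum degree at most `d + 1` that attains the lower bound on the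
rank. -/
structure AttainsRankBound (Φ : QuaternionGainGraph V) [DecidableRel Φ.graph.Adj] (d : ℕ) :
    Prop where
  connected : Φ.graph.Connected
  degree_le : ∀ v, Φ.graph.degree v ≤ d + 1
  card_eq : Fintype.card V = 2 + Φ.rank * d

namespace AttainsRankBound

variable {d : ℕ} (hΦ : Φ.AttainsRankBound d)
include hΦ

theorem le_card [DecidableEq V] {S : Finset V} {k : ℕ} (h : Φ.Covers S k) (hne : S.Nonempty)
    (hS : Φ.graph.NoIsolatedIn S) : 2 + k * d ≤ S.card := by
  have h1 := h.card_add_le hΦ.connected hΦ.degree_le hne hS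
  have h2 := hΦ.card_eq
  omega

theorem exists_adj (v : V) : ∃ w, Φ.graph.Adj v w := by
  have : Nontrivial V := Fintype.one_lt_card_iff_nontrivial.1 (by have := hΦ.card_eq; omega)
  exact (Φ.graph.degree_pos_iff_exists_adj v).1
    (hΦ.connected.preconnected.degree_pos_of_nontrivial v)

theorem degree_eq (v : V) : Φ.graph.degree v = d + 1 := by
  classical
  obtain ⟨w, hw⟩ := hΦ.exists_adj v
  have h1 := hΦ.le_card ((covers_neighborFinset hw).mono (Finset.subset_insert v _))
    (Finset.insert_nonempty _ _) (SimpleGraph.noIsolatedIn_insert_neighborFinset hw)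
  have h2 := Finset.card_insert_le v (Φ.graph.neighborFinset v)
  rw [Φ.graph.card_neighborFinset_eq_degree] at h2
  have h3 := hΦ.degree_le v
  omega

/-- The two neighbourhoods carry two independent rows, so their union needs at least 2 + 2d
vertices, which is the sum of their sizes. This gives triangle-freeness. -/
theorem disjoint_neighborFinset {x y : V} (h : Φ.graph.Adj x y) :
    Disjoint (Φ.graph.neighborFinset x) (Φ.graph.neighborFinset y) := by
  classical
  have h1 := hΦ.le_card (covers_union_neighborFinset h)
    ⟨x, by simpa using h.symm⟩ (SimpleGraph.noIsolatedIn_union_neighborFinset h)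
  have h2 := Finset.card_union_add_card_inter (Φ.graph.neighborFinset x)
    (Φ.graph.neighborFinset y)
  rw [Φ.graph.card_neighborFinset_eq_degree, Φ.graph.card_neighborFinset_eq_degree,
    hΦ.degree_eq, hΦ.degree_eq] at h2
  rw [Finset.disjoint_iff_inter_eq_empty, ← Finset.card_eq_zero]
  omega

theorem not_adj_of_adj_of_adj {x y z : V} (hxy : Φ.graph.Adj x y) (hxz : Φ.graph.Adj x z) :
    ¬ Φ.graph.Adj y z := fun hyz =>
  Finset.disjoint_left.1 (hΦ.disjoint_neighborFinset hxy) (by simpa using hxz)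
    (by simpa using hyz)

theorem card_union_neighborFinset [DecidableEq V] {x y : V} (h : Φ.graph.Adj x y) :
    (Φ.graph.neighborFinset x ∪ Φ.graph.neighborFinset y).card = 2 + 2 * d := by
  rw [Finset.card_union_of_disjoint (hΦ.disjoint_neighborFinset h),
    Φ.graph.card_neighborFinset_eq_degree, Φ.graph.card_neighborFinset_eq_degree,
    hΦ.degree_eq, hΦ.degree_eq]
  ring

theorem card_sdiff_eq [DecidableEq V] {S : Finset V} {k : ℕ} (h : Φ.Covers S k)
    (hS : Φ.graph.NoIsolatedIn S) (hcard : S.card = 2 + k * d) {u w : V} (hu : u ∈ S)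
    (hw : w ∉ S) (huw : Φ.graph.Adj u w) :
    (Φ.graph.neighborFinset u \ S).card = d ∧
      (S ∪ Φ.graph.neighborFinset u).card = 2 + (k + 1) * d := by
  have h1 := hΦ.le_card (h.union_neighborFinset hw huw) ⟨u, Finset.mem_union_left _ hu⟩
    (hS.union_neighborFinset hu)
  have h2 := hS.card_sdiff_lt hu
  rw [hΦ.degree_eq] at h2
  have h3 : (S ∪ Φ.graph.neighborFinset u).card
      = S.card + (Φ.graph.neighborFinset u \ S).card := by
    rw [← Finset.union_sdiff_self_eq_union, Finset.card_union_of_disjoint Finset.disjoint_sdiff]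
  have h4 : (k + 1) * d = k * d + d := by ring
  omega

/-- The union of N(x) and N(y) is tight and contains `w`. If `w` had a neighbour outside N(y), that
neighbour would lie outside the union, and `w` would add exactly d vertices. But its two neighbours
`x` and `z` are already inside, leaving at most d - 1. -/
theorem neighborFinset_eq_of_four_cycle {x y z w : V} (hxy : Φ.graph.Adj x y)
    (hxw : Φ.graph.Adj x w) (hzy : Φ.graph.Adj z y) (hzw : Φ.graph.Adj z w) (hxz : x ≠ z) :
    Φ.graph.neighborFinset w = Φ.graph.neighborFinset y := by
  classical
  refine Finset.eq_of_subset_of_card_le (fun t ht => ?_) (by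
    rw [Φ.graph.card_neighborFinset_eq_degree, Φ.graph.card_neighborFinset_eq_degree,
      hΦ.degree_eq, hΦ.degree_eq])
  by_contra hty
  have htx : t ∉ Φ.graph.neighborFinset x := fun htx =>
    Finset.disjoint_left.1 (hΦ.disjoint_neighborFinset hxw) htx ht
  have hS : t ∉ Φ.graph.neighborFinset x ∪ Φ.graph.neighborFinset y := by
    simp only [Finset.mem_union, not_or]
    exact ⟨htx, hty⟩
  have h1 := (hΦ.card_sdiff_eq (covers_union_neighborFinset hxy)
    (SimpleGraph.noIsolatedIn_union_neighborFinset hxy) (hΦ.card_union_neighborFinset hxy)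
    (u := w) (by simpa using Or.inl hxw) hS (by simpa using ht)).1
  have h2 : Φ.graph.neighborFinset w \ (Φ.graph.neighborFinset x ∪ Φ.graph.neighborFinset y)
      ⊆ ((Φ.graph.neighborFinset w).erase x).erase z := by
    intro s hs
    simp only [Finset.mem_sdiff, Finset.mem_union, SimpleGraph.mem_neighborFinset, not_or,
      Finset.mem_erase] at hs ⊢
    refine ⟨?_, ?_, hs.1⟩
    · rintro rfl
      exact hs.2.2 hzy.symm
    · rintro rfl
      exact hs.2.2 hxy.symm
  have h3 := Finset.card_le_card h2
  rw [Finset.card_erase_of_mem (by simpa using ⟨hxz.symm, hzw.symm⟩),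
    Finset.card_erase_of_mem (by simpa using hxw.symm),
    Φ.graph.card_neighborFinset_eq_degree, hΦ.degree_eq] at h3
  -- Excludes `d = 0`, where truncated subtraction would hide the contradiction.
  have h4 : 0 < d := by
    have h5 : ({x, z} : Finset V) ⊆ Φ.graph.neighborFinset w := by
      intro s
      simp only [Finset.mem_insert, Finset.mem_singleton, SimpleGraph.mem_neighborFinset]
      rintro (rfl | rfl)
      exacts [hxw.symm, hzw.symm]
    have h6 := Finset.card_le_card h5
    rw [Finset.card_pair hxz, Φ.graph.card_neighborFinset_eq_degree, hΦ.degree_eq] at h6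
    omega
  omega

theorem complete_bipartite_of_four_cycle {x y z w : V} (hxy : Φ.graph.Adj x y)
    (hxw : Φ.graph.Adj x w) (hzy : Φ.graph.Adj z y) (hzw : Φ.graph.Adj z w) (hxz : x ≠ z)
    (hyw : y ≠ w) :
    (∀ t, Φ.graph.Adj x t → Φ.graph.neighborFinset t = Φ.graph.neighborFinset y) ∧
    (∀ t, Φ.graph.Adj y t → Φ.graph.neighborFinset t = Φ.graph.neighborFinset x) ∧
    ∀ t, Φ.graph.Adj x t ∨ Φ.graph.Adj y t := by
  classical
  have hNw := hΦ.neighborFinset_eq_of_four_cycle hxy hxw hzy hzw hxz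
  have hNz := hΦ.neighborFinset_eq_of_four_cycle hxy.symm hzy.symm hxw.symm hzw.symm hyw
  have h1 : ∀ t, Φ.graph.Adj x t → Φ.graph.neighborFinset t = Φ.graph.neighborFinset y := by
    intro t ht
    refine hΦ.neighborFinset_eq_of_four_cycle hxy ht hzy ?_ hxz
    rwa [← SimpleGraph.mem_neighborFinset, hNz, SimpleGraph.mem_neighborFinset]
  have h2 : ∀ t, Φ.graph.Adj y t → Φ.graph.neighborFinset t = Φ.graph.neighborFinset x := by
    intro t ht
    refine hΦ.neighborFinset_eq_of_four_cycle hxy.symm ht hxw.symm ?_ hyw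
    rwa [← SimpleGraph.mem_neighborFinset, hNw, SimpleGraph.mem_neighborFinset]
  refine ⟨h1, h2, ?_⟩
  -- The union of N(x) and N(y) is closed under adjacency, hence everything by connectedness.
  by_contra! hne
  obtain ⟨t, htx, hty⟩ := hne
  obtain ⟨u, hu, v, hv, huv⟩ := hΦ.connected.exists_adj_of_ne_univ
    (S := Φ.graph.neighborFinset x ∪ Φ.graph.neighborFinset y)
    ⟨y, by simpa using hxy⟩ (fun h => by
      have := h ▸ Finset.mem_univ t
      simp [htx, hty] at this)
  rw [← SimpleGraph.mem_neighborFinset] at huv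
  simp only [Finset.mem_union, SimpleGraph.mem_neighborFinset] at hu hv
  rcases hu with hu | hu
  · rw [h1 u hu, SimpleGraph.mem_neighborFinset] at huv
    exact hv (Or.inr huv)
  · rw [h2 u hu, SimpleGraph.mem_neighborFinset] at huv
    exact hv (Or.inl huv)

/-- Take a maximal proper tight set S. Its next step fills the graph, so the complement has exactly
d ≥ 2 vertices, and every vertex of S with one neighbour outside is adjacent to all of them. Two
such vertices and two vertices of the complement form the 4-cycle. -/
theorem exists_four_cycle (hd : 2 ≤ d) : ∃ x y z w : V, Φ.graph.Adj x y ∧ Φ.graph.Adj x w ∧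
    Φ.graph.Adj z y ∧ Φ.graph.Adj z w ∧ x ≠ z ∧ y ≠ w := by
  classical
  obtain ⟨v⟩ := hΦ.connected.nonempty
  obtain ⟨v', hv'⟩ := hΦ.exists_adj v
  let P : Finset V → Prop := fun S => (∃ k, Φ.Covers S k ∧ S.card = 2 + k * d) ∧ S.Nonempty ∧
    Φ.graph.NoIsolatedIn S ∧ S ≠ Finset.univ
  have hP : P (insert v (Φ.graph.neighborFinset v)) := by
    refine ⟨⟨1, (covers_neighborFinset hv').mono (Finset.subset_insert v _), ?_⟩,
      Finset.insert_nonempty _ _, SimpleGraph.noIsolatedIn_insert_neighborFinset hv', ?_⟩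
    · rw [Finset.card_insert_of_notMem (by simp), Φ.graph.card_neighborFinset_eq_degree,
        hΦ.degree_eq]
      ring
    · intro h
      obtain ⟨t, ht, htv⟩ := Finset.exists_mem_ne (s := Φ.graph.neighborFinset v')
        (by rw [Φ.graph.card_neighborFinset_eq_degree, hΦ.degree_eq]; omega) v
      have h1 := h ▸ Finset.mem_univ t
      rw [SimpleGraph.mem_neighborFinset] at ht
      rw [Finset.mem_insert, SimpleGraph.mem_neighborFinset] at h1
      exact hΦ.not_adj_of_adj_of_adj hv' (h1.resolve_left htv) ht
  obtain ⟨S, hS⟩ := (Set.toFinite {S | P S}).exists_maximal ⟨_, hP⟩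
  obtain ⟨⟨k, hcov, hcard⟩, hne, hiso, huniv⟩ := hS.1
  obtain ⟨u, hu, a, ha, hua⟩ := hΦ.connected.exists_adj_of_ne_univ hne huniv
  have hstep := hΦ.card_sdiff_eq hcov hiso hcard hu ha hua
  have hfull : S ∪ Φ.graph.neighborFinset u = Finset.univ := by
    by_contra hnot
    have h1 : P (S ∪ Φ.graph.neighborFinset u) :=
      ⟨⟨k + 1, hcov.union_neighborFinset ha hua, hstep.2⟩,
        hne.mono Finset.subset_union_left, hiso.union_neighborFinset hu, hnot⟩
    exact ha (hS.2 h1 Finset.subset_union_left (by simp [hua]))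
  have hout : ∀ t, t ∉ S → Φ.graph.Adj u t := by
    intro t ht
    have h1 := hfull ▸ Finset.mem_univ t
    simpa [ht] using h1
  have hcompl : ∀ u', Φ.graph.neighborFinset u' \ S ⊆ Sᶜ := fun u' t ht => by
    simpa using (Finset.mem_sdiff.1 ht).2
  have hSc : Sᶜ.card = d := by
    rw [← hstep.1]
    congr 1
    refine le_antisymm (fun t ht => ?_) (hcompl u)
    rw [Finset.mem_compl] at ht
    simpa [ht] using hout t ht
  obtain ⟨b, hb, hba⟩ := Finset.exists_mem_ne (s := Sᶜ) (by omega) a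
  rw [Finset.mem_compl] at hb
  obtain ⟨u', hu', hne'⟩ := Finset.exists_mem_ne (s := Φ.graph.neighborFinset a)
    (by rw [Φ.graph.card_neighborFinset_eq_degree, hΦ.degree_eq]; omega) u
  rw [SimpleGraph.mem_neighborFinset] at hu'
  -- Otherwise `u`, `a` and `u'` form a triangle.
  have hu'S : u' ∈ S := by
    by_contra hnot
    exact hΦ.not_adj_of_adj_of_adj (hout a ha) (hout u' hnot) hu'
  have hstep' := hΦ.card_sdiff_eq hcov hiso hcard hu'S ha hu'.symm
  have hu'b : b ∈ Φ.graph.neighborFinset u' \ S := by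
    rw [Finset.eq_of_subset_of_card_le (hcompl u') (by rw [hSc, hstep'.1]), Finset.mem_compl]
    exact hb
  exact ⟨u, a, u', b, hua, hout b hb, hu'.symm, by simpa using (Finset.mem_sdiff.1 hu'b).1,
    hne'.symm, hba.symm⟩

end AttainsRankBound

/-- Two adjacent vertices whose neighbourhoods are the sides of a complete bipartite graph. -/
theorem isBalancedCompleteBipartite_of_adj {x y : V}
    (hx : ∀ t, Φ.graph.Adj x t → Φ.graph.neighborFinset t = Φ.graph.neighborFinset y)
    (hy : ∀ t, Φ.graph.Adj y t → Φ.graph.neighborFinset t = Φ.graph.neighborFinset x)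
    (hcover : ∀ t, Φ.graph.Adj x t ∨ Φ.graph.Adj y t)
    (hdisj : Disjoint (Φ.graph.neighborFinset x) (Φ.graph.neighborFinset y))
    (hdeg : Φ.graph.degree x = Φ.graph.degree y) : Φ.IsBalancedCompleteBipartite := by
  classical
  have hnot : ∀ t, ¬ Φ.graph.Adj x t ↔ Φ.graph.Adj y t := fun t =>
    ⟨(hcover t).resolve_left, fun h1 h2 =>
      Finset.disjoint_left.1 hdisj (by simpa using h2) (by simpa using h1)⟩
  have hadj_x : ∀ t, Φ.graph.Adj x t → ∀ s, Φ.graph.Adj t s ↔ Φ.graph.Adj y s := fun t ht s => by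
    rw [← SimpleGraph.mem_neighborFinset, hx t ht, SimpleGraph.mem_neighborFinset]
  have hadj_y : ∀ t, Φ.graph.Adj y t → ∀ s, Φ.graph.Adj t s ↔ Φ.graph.Adj x s := fun t ht s => by
    rw [← SimpleGraph.mem_neighborFinset, hy t ht, SimpleGraph.mem_neighborFinset]
  have hcx : Fintype.card {t // Φ.graph.Adj x t} = Φ.graph.degree x := by
    rw [← Φ.graph.card_neighborSet_eq_degree]
    exact Fintype.card_congr (Equiv.refl _)
  have hcy : Fintype.card {t // ¬ Φ.graph.Adj x t} = Φ.graph.degree x := by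
    rw [hdeg, ← Φ.graph.card_neighborSet_eq_degree]
    exact Fintype.card_congr (Equiv.subtypeEquivRight hnot)
  let e : V ≃ Fin (Φ.graph.degree x) ⊕ Fin (Φ.graph.degree x) :=
    (Equiv.sumCompl (Φ.graph.Adj x)).symm.trans
      (Equiv.sumCongr (Fintype.equivFinOfCardEq hcx) (Fintype.equivFinOfCardEq hcy))
  refine ⟨Φ.graph.degree x, ?_, ⟨⟨e, ?_⟩⟩⟩
  · rw [Fintype.card_congr e, Fintype.card_sum, Fintype.card_fin, two_mul]
  · intro a b
    by_cases ha : Φ.graph.Adj x a <;> by_cases hb : Φ.graph.Adj x b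
    · have h : ¬ Φ.graph.Adj y b := fun h => (hnot b).2 h hb
      simp [e, completeBipartiteGraph, Equiv.sumCompl_symm_apply_of_pos, ha, hb, hadj_x a ha, h]
    · have h := (hnot b).1 hb
      simp [e, completeBipartiteGraph, Equiv.sumCompl_symm_apply_of_pos,
        Equiv.sumCompl_symm_apply_of_neg, ha, hb, hadj_x a ha, h]
    · simp [e, completeBipartiteGraph, Equiv.sumCompl_symm_apply_of_pos,
        Equiv.sumCompl_symm_apply_of_neg, ha, hb, hadj_y a ((hnot a).1 ha)]
    · simp [e, completeBipartiteGraph, Equiv.sumCompl_symm_apply_of_neg, ha, hb,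
        hadj_y a ((hnot a).1 ha)]

end QuaternionGainGraph

/-! ### Four-cycles and proportional rows -/

namespace QuaternionGainGraph

variable {V : Type*} {Φ : QuaternionGainGraph V} [DecidableRel Φ.graph.Adj]

omit [DecidableRel Φ.graph.Adj] in
theorem walkGain_nil (u : V) : (Φ.walkGain (SimpleGraph.Walk.nil : Φ.graph.Walk u u) : ℍ[ℝ]) = 1 :=
  rfl

theorem walkGain_cons {u v w : V} (h : Φ.graph.Adj u v) (p : Φ.graph.Walk v w) :
    (Φ.walkGain (SimpleGraph.Walk.cons h p) : ℍ[ℝ]) = Φ.adjMatrix u v * Φ.walkGain p := by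
  rw [Φ.adjMatrix_of_adj h]
  simp only [walkGain, SimpleGraph.Walk.darts_cons, List.map_cons, List.prod_cons]
  rfl

omit [DecidableRel Φ.graph.Adj] in
theorem isCycle_four {a b c d : V} (hab : Φ.graph.Adj a b) (hbc : Φ.graph.Adj b c)
    (hcd : Φ.graph.Adj c d) (hda : Φ.graph.Adj d a) (hac : a ≠ c) (hbd : b ≠ d) :
    (SimpleGraph.Walk.cons hab (.cons hbc (.cons hcd (.cons hda .nil)))).IsCycle := by
  have h1 := hab.ne
  have h2 := hbc.ne
  have h3 := hcd.ne
  have h4 := hda.ne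
  rw [SimpleGraph.Walk.cons_isCycle_iff, SimpleGraph.Walk.isPath_def]
  simp
  grind

theorem isTypeOne_four_iff {a b c d : V} (hab : Φ.graph.Adj a b) (hbc : Φ.graph.Adj b c)
    (hcd : Φ.graph.Adj c d) (hda : Φ.graph.Adj d a) (hac : a ≠ c) (hbd : b ≠ d) :
    Φ.IsTypeOne (.cons hab (.cons hbc (.cons hcd (.cons hda .nil)))) ↔
      Φ.adjMatrix a b * Φ.adjMatrix b c * (Φ.adjMatrix c d * Φ.adjMatrix d a) = 1 := by
  simp only [IsTypeOne, isCycle_four hab hbc hcd hda hac hbd, walkGain_cons, walkGain_nil,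
    SimpleGraph.Walk.length_cons, SimpleGraph.Walk.length_nil, true_and, mul_one, mul_assoc]
  norm_num [show Even 4 by decide]

theorem forall_four_cycle_isTypeOne_iff :
    (∀ (v : V) (c : Φ.graph.Walk v v), c.IsCycle → c.length = 4 → Φ.IsTypeOne c) ↔
      ∀ a b c d : V, Φ.graph.Adj a b → Φ.graph.Adj b c → Φ.graph.Adj c d → Φ.graph.Adj d a →
        a ≠ c → b ≠ d →
        Φ.adjMatrix a b * Φ.adjMatrix b c * (Φ.adjMatrix c d * Φ.adjMatrix d a) = 1 := by
  constructor
  · intro h a b c d hab hbc hcd hda hac hbd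
    exact (isTypeOne_four_iff hab hbc hcd hda hac hbd).1
      (h a _ (isCycle_four hab hbc hcd hda hac hbd) rfl)
  · intro h v p hp hlen
    match p, hp, hlen with
    | .cons (v := b) hab (.cons (v := c) hbc (.cons (v := d) hcd (.cons hda .nil))), hp, _ =>
      have hnodup := hp.support_nodup
      simp only [SimpleGraph.Walk.support_cons, SimpleGraph.Walk.support_nil, List.tail_cons,
        List.nodup_cons, List.mem_cons, not_or] at hnodup
      have hac : v ≠ c := Ne.symm hnodup.2.1.2.1
      have hbd : b ≠ d := hnodup.1.2.1
      exact (isTypeOne_four_iff hab hbc hcd hda hac hbd).2 (h v b c d hab hbc hcd hda hac hbd)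

/-- Row c is q times row a; comparing entries at b and d, the factor q cancels from the gain. -/
theorem AttainsRankBound.four_cycle_gain_eq_one [Fintype V] {δ : ℕ} (hΦ : Φ.AttainsRankBound δ)
    (hrank : Φ.rank = 2) {a b c d : V} (hab : Φ.graph.Adj a b) (hbc : Φ.graph.Adj b c)
    (hcd : Φ.graph.Adj c d) (hda : Φ.graph.Adj d a) :
    Φ.adjMatrix a b * Φ.adjMatrix b c * (Φ.adjMatrix c d * Φ.adjMatrix d a) = 1 := by
  classical
  by_cases hca : Φ.adjMatrix.row c ∈ Submodule.span ℍ[ℝ] {Φ.adjMatrix.row a}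
  · obtain ⟨q, hq⟩ := Submodule.mem_span_singleton.1 hca
    have hb : Φ.adjMatrix c b = q * Φ.adjMatrix a b := (congrFun hq b).symm
    have hd : Φ.adjMatrix c d = q * Φ.adjMatrix a d := (congrFun hq d).symm
    rw [hd, mul_assoc q, Φ.adjMatrix_mul_swap hda.symm, mul_one, mul_assoc, mul_eq_one_comm,
      mul_assoc, ← hb, Φ.adjMatrix_mul_swap hbc]
  · exfalso
    have hac : ¬ Φ.graph.Adj a c := hΦ.not_adj_of_adj_of_adj hab.symm hbc
    have hne : c ≠ a := by
      rintro rfl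
      exact hca (Submodule.mem_span_singleton_self _)
    have hrow : Φ.adjMatrix.row a ≠ 0 := fun h =>
      Φ.adjMatrix_ne_zero hab (congrFun h b)
    have h2 : LinearIndepOn ℍ[ℝ] Φ.adjMatrix.row ({c, a} : Finset V) := by
      rw [Finset.coe_insert, Finset.coe_singleton]
      refine (LinearIndepOn.singleton hrow).insert ?_
      rwa [Set.image_singleton]
    -- Rows a and c vanish at column a while row b does not, so non-proportionality would give three
    -- independent rows.
    have hcov : Φ.Covers (Finset.univ.erase a) 2 := by
      refine ⟨{c, a}, Finset.card_pair hne, h2, ?_⟩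
      intro r hr w hrw
      simp only [Finset.mem_erase, Finset.mem_univ, and_true]
      rintro rfl
      simp only [Finset.mem_insert, Finset.mem_singleton] at hr
      rcases hr with rfl | rfl
      · exact hac hrw.symm
      · exact hrw.ne rfl
    have h3 := (hcov.union_neighborFinset (v := b) (w := a) (by simp) hab.symm).le_rank
    omega

theorem row_mem_span_of_four_cycles
    (h : ∀ a b c d : V, Φ.graph.Adj a b → Φ.graph.Adj b c → Φ.graph.Adj c d → Φ.graph.Adj d a →
      a ≠ c → b ≠ d → Φ.adjMatrix a b * Φ.adjMatrix b c * (Φ.adjMatrix c d * Φ.adjMatrix d a) = 1)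
    {x y v : V} (hxy : Φ.graph.Adj x y) (hv : ∀ w, Φ.graph.Adj v w ↔ Φ.graph.Adj x w) :
    Φ.adjMatrix.row v ∈ Submodule.span ℍ[ℝ] {Φ.adjMatrix.row x} := by
  refine Submodule.mem_span_singleton.2 ⟨Φ.adjMatrix v y * Φ.adjMatrix y x, funext fun w => ?_⟩
  change Φ.adjMatrix v y * Φ.adjMatrix y x * Φ.adjMatrix x w = Φ.adjMatrix v w
  by_cases hxw : Φ.graph.Adj x w
  · by_cases hwy : w = y
    · rw [hwy, mul_assoc, Φ.adjMatrix_mul_swap hxy.symm, mul_one]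
    by_cases hvx : x = v
    · rw [← hvx, Φ.adjMatrix_mul_swap hxy, one_mul]
    have h1 := h x w v y hxw ((hv w).2 hxw).symm ((hv y).2 hxy) hxy.symm hvx hwy
    rw [mul_eq_one_comm, ← mul_assoc] at h1
    calc _ = Φ.adjMatrix v y * Φ.adjMatrix y x * Φ.adjMatrix x w *
          (Φ.adjMatrix w v * Φ.adjMatrix v w) := by
          rw [Φ.adjMatrix_mul_swap ((hv w).2 hxw).symm, mul_one]
      _ = _ := by rw [← mul_assoc, h1, one_mul]
  · rw [Φ.adjMatrix_of_not_adj hxw, Φ.adjMatrix_of_not_adj fun h => hxw ((hv w).1 h), mul_zero]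

theorem attainsRankBound_of_isBalancedCompleteBipartite [Fintype V] (hconn : Φ.graph.Connected)
    (hΔ : 2 ≤ Φ.graph.maxDegree) (hK : Φ.IsBalancedCompleteBipartite)
    (h : ∀ a b c d : V, Φ.graph.Adj a b → Φ.graph.Adj b c → Φ.graph.Adj c d → Φ.graph.Adj d a →
      a ≠ c → b ≠ d →
      Φ.adjMatrix a b * Φ.adjMatrix b c * (Φ.adjMatrix c d * Φ.adjMatrix d a) = 1) :
    Φ.AttainsRankBound (Φ.graph.maxDegree - 1) := by
  classical
  obtain ⟨m, hm, ⟨e⟩⟩ := hK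
  have hadj : ∀ u v, Φ.graph.Adj u v ↔ (e u).isLeft ≠ (e v).isLeft := by
    intro u v
    rw [← e.map_adj_iff]
    cases e u <;> cases e v <;> simp
  have hdeg : Φ.graph.maxDegree ≤ m := by
    refine Φ.graph.maxDegree_le_of_forall_degree_le _ fun v => ?_
    have hside : ∃ g : Fin m → V, ∀ w, Φ.graph.Adj v w → ∃ j, g j = w := by
      cases hv : e v with
      | inl i =>
        refine ⟨fun j => e.symm (Sum.inr j), fun w hw => ?_⟩
        rw [hadj, hv] at hw
        cases hj : e w with
        | inl j => simp [hj] at hw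
        | inr j => exact ⟨j, e.symm_apply_eq.2 hj.symm⟩
      | inr i =>
        refine ⟨fun j => e.symm (Sum.inl j), fun w hw => ?_⟩
        rw [hadj, hv] at hw
        cases hj : e w with
        | inl j => exact ⟨j, e.symm_apply_eq.2 hj.symm⟩
        | inr j => simp [hj] at hw
    obtain ⟨g, hg⟩ := hside
    have hsub : Φ.graph.neighborFinset v ⊆ Finset.univ.image g := fun w hw => by
      simpa using hg w (by simpa using hw)
    simpa using (Finset.card_le_card hsub).trans Finset.card_image_le
  obtain ⟨x⟩ := hconn.nonempty
  have : Nontrivial V := Fintype.one_lt_card_iff_nontrivial.1 (by omega)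
  obtain ⟨y, hxy⟩ := (Φ.graph.degree_pos_iff_exists_adj x).1
    (hconn.preconnected.degree_pos_of_nontrivial x)
  have hrank : Φ.rank ≤ 2 := by
    rw [rank, rowLeftRank_eq_finrank]
    let B : Finset (V → ℍ[ℝ]) := {Φ.adjMatrix.row x, Φ.adjMatrix.row y}
    have hle : Submodule.span ℍ[ℝ] (Set.range Φ.adjMatrix.row)
        ≤ Submodule.span ℍ[ℝ] (B : Set (V → ℍ[ℝ])) := by
      rw [Submodule.span_le]
      rintro _ ⟨v, rfl⟩
      by_cases hv : (e v).isLeft = (e x).isLeft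
      · refine Submodule.span_mono ?_ (row_mem_span_of_four_cycles h hxy fun w => ?_)
        · simp [B]
        · rw [hadj, hadj, hv]
      · refine Submodule.span_mono ?_ (row_mem_span_of_four_cycles h hxy.symm fun w => ?_)
        · simp [B]
        · rw [hadj] at hxy
          rw [hadj, hadj, show (e v).isLeft = (e y).isLeft by
            revert hv hxy
            cases (e v).isLeft <;> cases (e x).isLeft <;> cases (e y).isLeft <;> simp]
    have : FiniteDimensional ℍ[ℝ] (Submodule.span ℍ[ℝ] (B : Set (V → ℍ[ℝ]))) :=
      FiniteDimensional.span_finset _ _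
    exact (Submodule.finrank_mono hle).trans
      ((finrank_span_finset_le_card _).trans Finset.card_le_two)
  have hdeg' : ∀ v, Φ.graph.degree v ≤ Φ.graph.maxDegree - 1 + 1 := fun v => by
    have := Φ.graph.degree_le_maxDegree v
    omega
  refine ⟨hconn, hdeg', ?_⟩
  have hbound := card_le_two_add_rank_mul hconn hdeg' hxy
  -- The chain n ≤ 2 + r(Δ - 1) ≤ 2Δ ≤ 2m = n collapses to equalities.
  have hmul := Nat.mul_le_mul_right (Φ.graph.maxDegree - 1) hrank
  omega

end QuaternionGainGraph

/-! ### The left null space along a spanning cycle -/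

namespace QuaternionGainGraph

variable {V : Type*} {Φ : QuaternionGainGraph V} [DecidableRel Φ.graph.Adj]

/-- The ordered product of the entries of the adjacency matrix along the first `i` steps of a
sequence of vertices. -/
noncomputable def prefixGain (Φ : QuaternionGainGraph V) [DecidableRel Φ.graph.Adj]
    (g : ℕ → V) (i : ℕ) : ℍ[ℝ] :=
  ((List.range i).map fun j => Φ.adjMatrix (g j) (g (j + 1))).prod

theorem prefixGain_zero (g : ℕ → V) : Φ.prefixGain g 0 = 1 := rfl

theorem prefixGain_succ (g : ℕ → V) (i : ℕ) :
    Φ.prefixGain g (i + 1) = Φ.prefixGain g i * Φ.adjMatrix (g i) (g (i + 1)) := by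
  simp [prefixGain, List.range_succ]

theorem prefixGain_succ' (g : ℕ → V) (i : ℕ) :
    Φ.prefixGain g (i + 1) = Φ.adjMatrix (g 0) (g 1) * Φ.prefixGain (fun j => g (j + 1)) i := by
  simp [prefixGain, List.range_succ_eq_map, Function.comp_def]

theorem walkGain_eq_prefixGain {u v : V} (p : Φ.graph.Walk u v) :
    (Φ.walkGain p : ℍ[ℝ]) = Φ.prefixGain p.getVert p.length := by
  induction p with
  | nil => rfl
  | cons h p ih =>
    rw [walkGain_cons, ih, SimpleGraph.Walk.length_cons, prefixGain_succ']
    simp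

theorem neg_one_pow_mul_self {R : Type*} [Ring R] (j : ℕ) : (-1 : R) ^ j * (-1) ^ j = 1 := by
  rw [← pow_add, Even.neg_one_pow ⟨j, rfl⟩]

variable [Fintype V]

theorem linearCombination_row_apply {u a b : V} (hab : a ≠ b)
    (hu : Φ.graph.neighborSet u = {a, b}) (f : V → ℍ[ℝ]) :
    Fintype.linearCombination ℍ[ℝ] Φ.adjMatrix.row f u
      = f a * Φ.adjMatrix a u + f b * Φ.adjMatrix b u := by
  classical
  rw [Fintype.linearCombination_apply, Finset.sum_apply, ← Finset.sum_pair
    (f := fun w => f w * Φ.adjMatrix w u) hab]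
  refine (Finset.sum_subset (Finset.subset_univ _) fun w _ hw => ?_).symm
  have hw' : ¬ Φ.graph.Adj w u := fun h => by
    have : w ∈ Φ.graph.neighborSet u := h.symm
    rw [hu] at this
    simp at hw this
    tauto
  change f w * Φ.adjMatrix w u = 0
  rw [Φ.adjMatrix_of_not_adj hw', mul_zero]

omit [DecidableRel Φ.graph.Adj] [Fintype V] in
theorem neighborSet_eq_toSubgraph {v : V} {c : Φ.graph.Walk v v}
    (hadj : ∀ a b, Φ.graph.Adj a b → c.toSubgraph.Adj a b) (u : V) :
    Φ.graph.neighborSet u = c.toSubgraph.neighborSet u :=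
  Set.Subset.antisymm (fun b hb => hadj u b hb) (c.toSubgraph.neighborSet_subset u)

section SpanningCycle

variable {v : V} {c : Φ.graph.Walk v v} (hc : c.IsCycle) (hsupp : ∀ w, w ∈ c.support)
  (hadj : ∀ a b, Φ.graph.Adj a b → c.toSubgraph.Adj a b)
include hc hadj

theorem linearCombination_getVert {i : ℕ} (hi : i + 1 < c.length) (f : V → ℍ[ℝ]) :
    Fintype.linearCombination ℍ[ℝ] Φ.adjMatrix.row f (c.getVert (i + 1))
      = f (c.getVert i) * Φ.adjMatrix (c.getVert i) (c.getVert (i + 1))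
        + f (c.getVert (i + 2)) * Φ.adjMatrix (c.getVert (i + 2)) (c.getVert (i + 1)) := by
  have h1 := hc.getVert_sub_one_ne_getVert_add_one hi.le
  refine linearCombination_row_apply h1 ?_ f
  rw [neighborSet_eq_toSubgraph hadj,
    hc.neighborSet_toSubgraph_internal (Nat.succ_ne_zero i) hi]

theorem linearCombination_startpoint (f : V → ℍ[ℝ]) :
    Fintype.linearCombination ℍ[ℝ] Φ.adjMatrix.row f v
      = f (c.getVert 1) * Φ.adjMatrix (c.getVert 1) v
        + f (c.getVert (c.length - 1)) * Φ.adjMatrix (c.getVert (c.length - 1)) v := by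
  refine linearCombination_row_apply hc.snd_ne_penultimate ?_ f
  rw [neighborSet_eq_toSubgraph hadj, hc.neighborSet_toSubgraph_endpoint]

/-- Column i + 1 of the null equation has two terms. This recursion preserves the parity of the
position and propagates null vectors. -/
theorem apply_getVert_add_two {f : V → ℍ[ℝ]}
    (hf : Fintype.linearCombination ℍ[ℝ] Φ.adjMatrix.row f = 0) {i : ℕ} (hi : i + 1 < c.length) :
    f (c.getVert (i + 2)) = -(f (c.getVert i) * Φ.adjMatrix (c.getVert i) (c.getVert (i + 1))
      * Φ.adjMatrix (c.getVert (i + 1)) (c.getVert (i + 2))) := by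
  have h1 := linearCombination_getVert hc hadj hi f
  rw [hf, Pi.zero_apply] at h1
  have h2 := Φ.adjMatrix_mul_swap (c.adj_getVert_succ hi).symm
  rw [← mul_one (f (c.getVert (i + 2))), ← h2, ← mul_assoc, ← neg_mul,
    eq_neg_of_add_eq_zero_right h1.symm]

include hsupp

theorem isTypeOne_of_rank_add_two (hrank : Φ.rank + 2 = Fintype.card V) : Φ.IsTypeOne c := by
  have hlen := hc.three_le_length
  let K := LinearMap.ker (Fintype.linearCombination ℍ[ℝ] Φ.adjMatrix.row)
  have hK : Module.finrank ℍ[ℝ] K = 2 := by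
    have : Φ.rank + Module.finrank ℍ[ℝ] K = Fintype.card V :=
      rowLeftRank_add_finrank_ker Φ.adjMatrix
    omega
  let ev : K →ₗ[ℍ[ℝ]] ℍ[ℝ] × ℍ[ℝ] :=
    ((LinearMap.proj (R := ℍ[ℝ]) (φ := fun _ : V => ℍ[ℝ]) v).prod
      (LinearMap.proj (c.getVert 1))).comp K.subtype
  have hinj : Function.Injective ev := by
    rw [injective_iff_map_eq_zero]
    rintro ⟨f, hf⟩ h
    have h0 : f v = 0 := congrArg Prod.fst h
    have h1 : f (c.getVert 1) = 0 := congrArg Prod.snd h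
    have hall : ∀ i, (i ≤ c.length → f (c.getVert i) = 0) ∧
        (i + 1 ≤ c.length → f (c.getVert (i + 1)) = 0) := by
      intro i
      induction i with
      | zero => exact ⟨fun _ => by rw [c.getVert_zero, h0], fun _ => h1⟩
      | succ i ih =>
        refine ⟨ih.2, fun hi => ?_⟩
        rw [apply_getVert_add_two hc hadj (LinearMap.mem_ker.1 hf) (by omega),
          ih.1 (by omega)]
        simp
    refine Subtype.ext (funext fun w => ?_)
    obtain ⟨i, rfl, hi⟩ := SimpleGraph.Walk.mem_support_iff_exists_getVert.1 (hsupp w)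
    exact (hall i).1 hi
  -- Two consecutive values determine a null vector; as the dimension is 2, they can also be
  -- prescribed freely.
  have hsurj : Function.Surjective ev := by
    refine (LinearMap.injective_iff_surjective_of_finrank_eq_finrank ?_).1 hinj
    rw [hK, Module.finrank_prod, Module.finrank_self]
  obtain ⟨⟨f, hf⟩, hev⟩ := hsurj (1, 0)
  rw [LinearMap.mem_ker] at hf
  have h0 : f v = 1 := congrArg Prod.fst hev
  have h1 : f (c.getVert 1) = 0 := congrArg Prod.snd hev
  have hodd : ∀ j, 2 * j + 1 ≤ c.length → f (c.getVert (2 * j + 1)) = 0 := by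
    intro j
    induction j with
    | zero => exact fun _ => h1
    | succ j ih =>
      intro hj
      rw [show 2 * (j + 1) + 1 = 2 * j + 1 + 2 by ring,
        apply_getVert_add_two hc hadj hf (by omega), ih (by omega)]
      simp
  have heven : ∀ j, 2 * j ≤ c.length →
      f (c.getVert (2 * j)) = (-1) ^ j * Φ.prefixGain c.getVert (2 * j) := by
    intro j
    induction j with
    | zero => intro; simp [h0, prefixGain_zero]
    | succ j ih =>
      intro hj
      rw [show 2 * (j + 1) = 2 * j + 2 by ring, apply_getVert_add_two hc hadj hf (by omega),
        ih (by omega), prefixGain_succ, prefixGain_succ, pow_succ]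
      simp [mul_assoc]
  have hlast : f (c.getVert c.length) = 1 := by rw [c.getVert_length, h0]
  rcases Nat.even_or_odd' c.length with ⟨j, hj | hj⟩
  · refine ⟨hc, ⟨j, by omega⟩, ?_⟩
    have h2 := heven j hj.ge
    rw [← hj, hlast] at h2
    rw [walkGain_eq_prefixGain, show c.length / 2 = j by omega]
    calc _ = ((-1 : ℍ[ℝ]) ^ j * (-1) ^ j) * Φ.prefixGain c.getVert c.length := by
          rw [neg_one_pow_mul_self, one_mul]
      _ = (-1) ^ j := by rw [mul_assoc, ← h2, mul_one]
  -- For odd length, returning to `v` at an odd position would force the value 0 where it is 1.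
  · have h2 := hodd j hj.ge
    rw [← hj, hlast] at h2
    exact absurd h2 one_ne_zero

theorem rank_add_two_le_of_isTypeOne (htype : Φ.IsTypeOne c) :
    Φ.rank + 2 ≤ Fintype.card V := by
  obtain ⟨-, hev, hgain⟩ := htype
  rw [walkGain_eq_prefixGain] at hgain
  have hlen := hc.three_le_length
  have hidx : ∀ w, ∃ i, i < c.length ∧ c.getVert i = w := by
    intro w
    obtain ⟨i, rfl, hi⟩ := SimpleGraph.Walk.mem_support_iff_exists_getVert.1 (hsupp w)
    rcases hi.lt_or_eq with hi | rfl
    · exact ⟨i, hi, rfl⟩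
    · exact ⟨0, by omega, by simp⟩
  choose idx hidx_lt hidx_eq using hidx
  have hidx_getVert : ∀ i, i < c.length → idx (c.getVert i) = i := fun i hi =>
    hc.getVert_injOn' (by have := hidx_lt (c.getVert i); simp; omega) (by simp; omega)
      (hidx_eq _)
  -- `h` solves the recursion separately on even and odd positions; `f 0` and `f 1` are its two
  -- halves. Even length makes parity consistent around the cycle, and Type 1 closes `h` up.
  let h : ℕ → ℍ[ℝ] := fun i => (-1) ^ (i / 2) * Φ.prefixGain c.getVert i
  let f : ℕ → V → ℍ[ℝ] := fun ε w => if idx w % 2 = ε then h (idx w) else 0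
  have hf : ∀ ε i, i ≤ c.length → f ε (c.getVert i) = if i % 2 = ε then h i else 0 := by
    intro ε i hi
    rcases hi.lt_or_eq with hi | rfl
    · simp only [f, hidx_getVert i hi]
    · have h0 : h c.length = h 0 := by
        simp [h, hgain, neg_one_pow_mul_self, prefixGain_zero]
      have hv : idx v = 0 := by
        have := hidx_getVert 0 (by omega)
        rwa [c.getVert_zero] at this
      simp only [f, c.getVert_length, hv, Nat.even_iff.1 hev, h0, Nat.zero_mod]
  have hstep : ∀ i, i + 1 < c.length →
      h i * Φ.adjMatrix (c.getVert i) (c.getVert (i + 1))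
        + h (i + 2) * Φ.adjMatrix (c.getVert (i + 2)) (c.getVert (i + 1)) = 0 := by
    intro i hi
    simp only [h]
    rw [prefixGain_succ, prefixGain_succ, show (i + 2) / 2 = i / 2 + 1 by omega, pow_succ]
    simp only [mul_assoc]
    rw [Φ.adjMatrix_mul_swap (c.adj_getVert_succ hi)]
    simp
  have hker : ∀ ε, f ε ∈ LinearMap.ker (Fintype.linearCombination ℍ[ℝ] Φ.adjMatrix.row) := by
    intro ε
    refine LinearMap.mem_ker.2 (funext fun w => ?_)
    rw [← hidx_eq w, Pi.zero_apply]
    have hw := hidx_lt w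
    cases hi : idx w with
    | succ i =>
      rw [linearCombination_getVert hc hadj (by omega), hf ε i (by omega),
        hf ε (i + 2) (by omega), Nat.add_mod_right]
      split_ifs
      · exact hstep i (by omega)
      · simp
    | zero =>
      obtain ⟨j, hj⟩ := hev
      obtain ⟨k, rfl⟩ : ∃ k, j = k + 1 := ⟨j - 1, by omega⟩
      rw [c.getVert_zero, linearCombination_startpoint hc hadj, hf ε 1 (by omega),
        hf ε (c.length - 1) (by omega), show (c.length - 1) % 2 = 1 % 2 by omega]
      split_ifs
      · have h1 : h 1 * Φ.adjMatrix (c.getVert 1) v = 1 := by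
          have := Φ.adjMatrix_mul_swap (c.adj_getVert_succ (i := 0) (by omega))
          simpa [h, prefixGain_succ, prefixGain_zero] using this
        have h2 : Φ.prefixGain c.getVert (c.length - 1)
            * Φ.adjMatrix (c.getVert (c.length - 1)) v = (-1) ^ (c.length / 2) := by
          rw [← hgain]
          conv_rhs => rw [show c.length = c.length - 1 + 1 by omega, prefixGain_succ]
          rw [show c.length - 1 + 1 = c.length by omega, c.getVert_length]
        rw [h1]
        simp only [h]
        rw [mul_assoc, h2, show (c.length - 1) / 2 = k by omega,
          show c.length / 2 = k + 1 by omega, pow_succ, ← mul_assoc,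
          neg_one_pow_mul_self]
        simp
      · simp
  -- The positions 0 and 1 separate the two null vectors.
  have hv : ∀ ε, f ε v = if 0 % 2 = ε then h 0 else 0 := fun ε => by
    have := hf ε 0 (by omega)
    rwa [c.getVert_zero] at this
  have hli : LinearIndependent ℍ[ℝ]
      ![(⟨f 0, hker 0⟩ : LinearMap.ker (Fintype.linearCombination ℍ[ℝ] Φ.adjMatrix.row)),
        ⟨f 1, hker 1⟩] := by
    rw [LinearIndependent.pair_iff]
    intro s t hst
    have h1 : s • f 0 + t • f 1 = 0 := congrArg Subtype.val hst
    have h2 := congrFun h1 v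
    have h3 := congrFun h1 (c.getVert 1)
    simp only [Pi.add_apply, Pi.smul_apply, Pi.zero_apply, smul_eq_mul, hv,
      hf _ 1 (by omega : 1 ≤ c.length)] at h2 h3
    simp only [h, prefixGain_succ, prefixGain_zero] at h2 h3
    norm_num at h2 h3
    have h4 := Φ.adjMatrix_ne_zero (c.adj_getVert_succ (i := 0) (by omega))
    refine ⟨h2, h3.resolve_right ?_⟩
    simpa using h4
  have h1 := hli.fintype_card_le_finrank
  have h2 := rowLeftRank_add_finrank_ker Φ.adjMatrix
  rw [Fintype.card_fin] at h1
  rw [rank]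
  omega

end SpanningCycle

end QuaternionGainGraph

/-! ### The cases Δ = 2 and Δ ≥ 3 -/

namespace QuaternionGainGraph

variable {V : Type*} {Φ : QuaternionGainGraph V} [DecidableRel Φ.graph.Adj] [Fintype V]

theorem attainsRankBound_iff (hconn : Φ.graph.Connected) (hΔ : 2 ≤ Φ.graph.maxDegree) :
    Φ.AttainsRankBound (Φ.graph.maxDegree - 1) ↔
      (Φ.rank : ℚ) = ((Fintype.card V : ℚ) - 2) / ((Φ.graph.maxDegree : ℚ) - 1) := by
  have hcast : ((Φ.graph.maxDegree : ℚ) - 1) = ((Φ.graph.maxDegree - 1 : ℕ) : ℚ) := by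
    rw [Nat.cast_sub (by omega), Nat.cast_one]
  have hpos : ((Φ.graph.maxDegree - 1 : ℕ) : ℚ) ≠ 0 := by
    rw [Nat.cast_ne_zero]
    omega
  rw [hcast, eq_div_iff hpos, eq_sub_iff_add_eq']
  have hdeg : ∀ v, Φ.graph.degree v ≤ Φ.graph.maxDegree - 1 + 1 := fun v => by
    have := Φ.graph.degree_le_maxDegree v
    omega
  constructor
  · intro h
    exact_mod_cast h.card_eq.symm
  · intro h
    exact ⟨hconn, hdeg, by exact_mod_cast h.symm⟩

theorem AttainsRankBound.isTypeOneCycle (hΦ : Φ.AttainsRankBound 1) : Φ.IsTypeOneCycle := by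
  classical
  have hcyc : Φ.graph.IsCycles := fun u _ => by
    rw [Set.ncard_eq_toFinset_card', Set.toFinset_card, Φ.graph.card_neighborSet_eq_degree,
      hΦ.degree_eq]
  obtain ⟨v⟩ := hΦ.connected.nonempty
  obtain ⟨w, hw⟩ := hΦ.exists_adj v
  obtain ⟨c, hc, hverts⟩ := hcyc.exists_cycle_toSubgraph_verts_eq_connectedComponentSupp
    (c := Φ.graph.connectedComponentMk v) rfl ⟨w, hw⟩
  have hmem : ∀ u, u ∈ c.toSubgraph.verts := fun u => by
    rw [hverts, SimpleGraph.ConnectedComponent.mem_supp_iff, SimpleGraph.ConnectedComponent.eq]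
    exact hΦ.connected.preconnected u v
  have hsupp : ∀ u, u ∈ c.support := fun u => c.mem_verts_toSubgraph.1 (hmem u)
  have hadj : ∀ a b, Φ.graph.Adj a b → c.toSubgraph.Adj a b := fun a b =>
    (hc.adj_toSubgraph_iff_of_isCycles hcyc (hmem a) b).2
  refine ⟨v, c, isTypeOne_of_rank_add_two hc hsupp hadj ?_, hsupp, fun e he => ?_⟩
  · have := hΦ.card_eq
    omega
  · induction e with
    | _ a b => exact SimpleGraph.Walk.adj_toSubgraph_iff_mem_edges.1 (hadj a b he)

theorem IsTypeOneCycle.attainsRankBound (hconn : Φ.graph.Connected) (h : Φ.IsTypeOneCycle) :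
    Φ.graph.maxDegree ≤ 2 ∧ Φ.AttainsRankBound 1 := by
  obtain ⟨v, c, htype, hsupp, hedges⟩ := h
  have hc := htype.1
  have hadj : ∀ a b, Φ.graph.Adj a b → c.toSubgraph.Adj a b := fun a b hab =>
    SimpleGraph.Walk.adj_toSubgraph_iff_mem_edges.2 (hedges _ hab)
  have hdeg : ∀ u, Φ.graph.degree u = 2 := fun u => by
    rw [← hc.ncard_neighborSet_toSubgraph_eq_two (hsupp u), ← neighborSet_eq_toSubgraph hadj,
      Set.ncard_eq_toFinset_card', Set.toFinset_card, Φ.graph.card_neighborSet_eq_degree]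
  refine ⟨Φ.graph.maxDegree_le_of_forall_degree_le _ fun u => (hdeg u).le, hconn,
    fun u => (hdeg u).le, ?_⟩
  have h1 := rank_add_two_le_of_isTypeOne hc hsupp hadj htype
  have h2 := card_le_two_add_rank_mul hconn (fun u => (hdeg u).le) (c.adj_snd hc.not_nil)
  omega

theorem AttainsRankBound.isBalancedCompleteBipartite {d : ℕ} (hΦ : Φ.AttainsRankBound d)
    (hd : 2 ≤ d) : Φ.IsBalancedCompleteBipartite ∧ Φ.rank = 2 := by
  classical
  obtain ⟨x, y, z, w, hxy, hxw, hzy, hzw, hxz, hyw⟩ := hΦ.exists_four_cycle hd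
  obtain ⟨h1, h2, h3⟩ := hΦ.complete_bipartite_of_four_cycle hxy hxw hzy hzw hxz hyw
  refine ⟨isBalancedCompleteBipartite_of_adj h1 h2 h3 (hΦ.disjoint_neighborFinset hxy)
    (by rw [hΦ.degree_eq, hΦ.degree_eq]), ?_⟩
  have huniv : Φ.graph.neighborFinset x ∪ Φ.graph.neighborFinset y = Finset.univ := by
    ext t
    simpa using h3 t
  have hcard := hΦ.card_union_neighborFinset hxy
  rw [huniv, Finset.card_univ, hΦ.card_eq] at hcard
  -- Counting the vertices twice gives 2 + r d = 2 + 2d.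
  exact Nat.eq_of_mul_eq_mul_right (by omega : 0 < d) (by omega)

end QuaternionGainGraph

theorem theorem4p3 {V : Type*} [Fintype V] (Φ : QuaternionGainGraph V)
    [DecidableRel Φ.graph.Adj] (hconn : Φ.graph.Connected) (hΔ : 2 ≤ Φ.graph.maxDegree) :
    (Φ.rank : ℚ) = ((Fintype.card V : ℚ) - 2) / ((Φ.graph.maxDegree : ℚ) - 1) ↔
      Φ.IsTypeOneCycle ∨
        (Φ.IsBalancedCompleteBipartite ∧
          ∀ (v : V) (c : Φ.graph.Walk v v), c.IsCycle → c.length = 4 → Φ.IsTypeOne c) := by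
  rw [← QuaternionGainGraph.attainsRankBound_iff hconn hΔ,
    QuaternionGainGraph.forall_four_cycle_isTypeOne_iff]
  constructor
  · intro hΦ
    rcases hΔ.eq_or_lt with hΔ | hΔ
    · rw [← hΔ] at hΦ
      exact Or.inl hΦ.isTypeOneCycle
    · obtain ⟨hK, hrank⟩ := hΦ.isBalancedCompleteBipartite (by omega)
      exact Or.inr ⟨hK, fun a b c d hab hbc hcd hda _ _ =>
        hΦ.four_cycle_gain_eq_one hrank hab hbc hcd hda⟩
  · rintro (h | ⟨hK, h⟩)
    · obtain ⟨hle, hΦ⟩ := h.attainsRankBound hconn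
      rwa [show Φ.graph.maxDegree - 1 = 1 by omega]
    · exact QuaternionGainGraph.attainsRankBound_of_isBalancedCompleteBipartite hconn hΔ hK h
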